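/- Let $n$ be an even positive integer and let $S$ be a set of $n$ points in general position in $\mathbb{R}^2$ (no three on a line). A halving line of $S$ is a line through two points of $S$ that has the same number of the remaining $n-2$ points on each side. The underlying graph of $S$ is the graph whose vertices are the points of $S$, two points being adjacent if and only if the line through them is a halving line. The length of a cycle is its number of vertices. (a) For every such $n$ and $S$, no cycle of the underlying graph of $S$ contains a vertex of the convex hull of $S$, and every cycle of the underlying graph of $S$ has length at most $n-3$. (b) If moreover $n$ is divisible by $6$, then the maximum length of a cycle, over the underlying graphs of all sets of $n$ points in general position in $\mathbb{R}^2$, is exactly $n-3$; that is, the bound in (a) is attained by some such set. -/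

import Mathlib

/-- The Euclidean plane. -/
abbrev Plane : Type := EuclideanSpace ℝ (Fin 2)

/-- General position: no three distinct points of the set lie on a line. -/
def InGeneralPosition (S : Finset Plane) : Prop :=
  ∀ p ∈ S, ∀ q ∈ S, ∀ r ∈ S, p ≠ q → p ≠ r → q ≠ r →
    ¬ Collinear ℝ ({p, q, r} : Set Plane)

/-- Twice the signed area of the triangle `p q r`. For `p ≠ q` it is positive on one open side
of the line through `p` and `q`, negative on the other, and zero exactly on the line. -/
def orient (p q r : Plane) : ℝ :=
  (q 0 - p 0) * (r 1 - p 1) - (q 1 - p 1) * (r 0 - p 0)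

open Classical in
/-- The line through the two distinct points `p`, `q` is a halving line of `S`: its two open
sides contain equally many points of `S`. (In general position `p` and `q` are the only points
of `S` on the line.) -/
def IsHalvingPair (S : Finset Plane) (p q : Plane) : Prop :=
  p ≠ q ∧ (S.filter (fun r => 0 < orient p q r)).card =
    (S.filter (fun r => orient p q r < 0)).card

theorem orient_swap (p q r : Plane) : orient q p r = - orient p q r := by
  unfold orient; ring

theorem IsHalvingPair.symm {S : Finset Plane} {p q : Plane} (h : IsHalvingPair S p q) :
    IsHalvingPair S q p := by
  refine ⟨h.1.symm, ?_⟩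
  simp only [orient_swap p q, Left.neg_pos_iff, Left.neg_neg_iff]
  exact h.2.symm

/-- The underlying graph of `S`: its vertices are the points of `S`, and two points are adjacent
iff the line through them is a halving line. -/
def underlyingGraph (S : Finset Plane) : SimpleGraph S where
  Adj p q := IsHalvingPair S p q
  symm := ⟨fun _ _ h => h.symm⟩
  loopless := ⟨fun _ h => h.1 rfl⟩

/-- `S` is a set of `n` points in general position in the plane. -/
def IsConfiguration (n : ℕ) (S : Finset Plane) : Prop :=
  S.card = n ∧ InGeneralPosition S

/-- The point `p` is a vertex of the convex hull of `S`. -/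
def IsHullVertex (S : Finset Plane) (p : Plane) : Prop :=
  p ∈ (convexHull ℝ (S : Set Plane)).extremePoints ℝ

/-! Upper bound: as a line turns about a hull vertex, the parts of the set on its positive side are
nested, so at most one other point gives a halving line (`IsHullVertex.halving_unique`). A cycle
vertex has two neighbours, so cycles avoid the hull vertices, of which there are at least three.

Construction for `6 * k` points: three arms leave a centre, each with a cluster of `k` inner points
at limit distance 1 and, farther out, a chain of `k` points on a flat parabola. The arms straighten
as `ε` tends to 0; orientations are quadratic in `ε`, so for small positive `ε` the lowest nonzero
coefficient gives the sign.

A line through two points of one arm with different limit radii has the other arms on opposite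
sides, so only its own arm must balance (`isEdge_same_arm`). This yields a path from inner point 0
along the chain, without its outermost point, to inner point 1. A line joining inner points of
neighbouring arms halves when their ranks in the facing view orders agree (`isEdge_next_arm`). One
displaced inner point turns the rank matching around the arms into a cyclic shift, so the `3 * k`
inner points form a single cycle. Trading three of its edges for the three chain paths gives a cycle
missing only the three outermost points. -/

open Filter Topology

/-! ### Hull vertices and the upper bound -/

/-- Three points spanning a positively oriented triangle around `p` contain `p` in the relative
interior of their hull, so `p` is not extreme. -/
theorem not_isHullVertex_of_surrounded {S : Finset Plane} {p q r s : Plane}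
    (hq : q ∈ S) (hr : r ∈ S) (hs : s ∈ S) (h₁ : 0 < orient p q r) (h₂ : 0 < orient p r s)
    (h₃ : 0 < orient p s q) : ¬ IsHullVertex S p := by
  intro hp
  have hne : q ≠ p := by
    rintro rfl
    simp [orient] at h₁
  have hW : 0 < orient p q r + orient p s q := by positivity
  have hT : 0 < orient p q r + orient p r s + orient p s q := by positivity
  -- `t` is where the ray from `q` through `p` meets the segment from `r` to `s`; the weights are
  -- the barycentric coordinates of `p`, given by areas.
  set t : Plane := (orient p s q / (orient p q r + orient p s q)) • r +
    (orient p q r / (orient p q r + orient p s q)) • s with ht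
  have hmem : ∀ x ∈ S, x ∈ convexHull ℝ (S : Set Plane) := fun x hx =>
    subset_convexHull ℝ _ (by exact_mod_cast hx)
  have htm : t ∈ convexHull ℝ (S : Set Plane) :=
    (convex_convexHull ℝ _) (hmem r hr) (hmem s hs) (by positivity) (by positivity)
      (by field_simp; ring)
  refine hne (hp.2 (hmem q hq) htm ⟨orient p r s / (orient p q r + orient p r s + orient p s q),
    (orient p q r + orient p s q) / (orient p q r + orient p r s + orient p s q),
    by positivity, by positivity, by field_simp; ring, ?_⟩)
  have key : ∀ i : Fin 2, orient p r s * q i + orient p s q * r i + orient p q r * s i =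
      (orient p q r + orient p r s + orient p s q) * p i := by
    intro i
    fin_cases i <;> simp [orient] <;> ring
  ext i
  simp only [ht, PiLp.add_apply, PiLp.smul_apply, smul_eq_mul]
  have := key i
  field_simp
  linarith

theorem orient_rotate (p q r : Plane) : orient q r p = orient p q r := by
  unfold orient; ring

theorem orient_swap_right (p q r : Plane) : orient p r q = - orient p q r := by
  unfold orient; ring

theorem collinear_of_orient_eq_zero {p q r : Plane} (h : orient p q r = 0) :
    Collinear ℝ ({p, q, r} : Set Plane) := by
  by_cases hpq : p = q
  · subst hpq
    simpa using collinear_pair ℝ p r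
  rw [collinear_iff_of_mem (p₀ := p) (by simp)]
  refine ⟨q - p, ?_⟩
  have hsq : 0 < (q 0 - p 0) ^ 2 + (q 1 - p 1) ^ 2 := by
    by_contra hcon
    apply hpq
    have h0 : q 0 - p 0 = 0 := by nlinarith [sq_nonneg (q 0 - p 0), sq_nonneg (q 1 - p 1)]
    have h1 : q 1 - p 1 = 0 := by nlinarith [sq_nonneg (q 0 - p 0), sq_nonneg (q 1 - p 1)]
    ext i
    fin_cases i <;> simp <;> linarith
  intro x hx
  rcases hx with rfl | rfl | hx
  · exact ⟨0, by simp⟩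
  · exact ⟨1, by simp⟩
  · obtain rfl : x = r := hx
    refine ⟨((x 0 - p 0) * (q 0 - p 0) + (x 1 - p 1) * (q 1 - p 1)) /
      ((q 0 - p 0) ^ 2 + (q 1 - p 1) ^ 2), ?_⟩
    unfold orient at h
    ext i
    fin_cases i <;> simp <;> field_simp
    · linear_combination (q 1 - p 1) * (-h)
    · linear_combination (q 0 - p 0) * h

theorem orient_eq_zero_of_collinear {p q r : Plane} (h : Collinear ℝ ({p, q, r} : Set Plane)) :
    orient p q r = 0 := by
  rw [collinear_iff_of_mem (p₀ := p) (by simp)] at h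
  obtain ⟨v, hv⟩ := h
  obtain ⟨a, rfl⟩ := hv q (by simp)
  obtain ⟨b, rfl⟩ := hv r (by simp)
  simp [orient]
  ring

open Classical in
theorem card_pos_add_card_neg {S : Finset Plane} (hS : InGeneralPosition S) {p q : Plane}
    (hp : p ∈ S) (hq : q ∈ S) (hpq : p ≠ q) :
    (S.filter (fun r => 0 < orient p q r)).card + (S.filter (fun r => orient p q r < 0)).card + 2
      = S.card := by
  have hdisj : Disjoint (S.filter (fun r => 0 < orient p q r))
      (S.filter (fun r => orient p q r < 0)) := by
    rw [Finset.disjoint_filter]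
    intro x _ h1 h2
    exact lt_asymm h1 h2
  have hdisj2 : Disjoint ((S.filter (fun r => 0 < orient p q r)) ∪
      (S.filter (fun r => orient p q r < 0))) {p, q} := by
    rw [Finset.disjoint_right]
    intro x hx
    have hx0 : orient p q x = 0 := by
      rcases Finset.mem_insert.1 hx with rfl | hx
      · simp [orient]
      · rw [Finset.mem_singleton.1 hx]; unfold orient; ring
    simp [hx0]
  have hunion : (S.filter (fun r => 0 < orient p q r)) ∪ (S.filter (fun r => orient p q r < 0)) ∪
      {p, q} = S := ?_
  · rw [← Finset.card_union_of_disjoint hdisj, ← congrArg Finset.card hunion,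
      Finset.card_union_of_disjoint hdisj2, Finset.card_pair hpq]
  ext x
  simp only [Finset.mem_union, Finset.mem_filter, Finset.mem_insert, Finset.mem_singleton]
  constructor
  · rintro ((h | h) | (rfl | rfl))
    exacts [h.1, h.1, hp, hq]
  · intro hx
    by_cases h1 : x = p
    · exact Or.inr (Or.inl h1)
    by_cases h2 : x = q
    · exact Or.inr (Or.inr h2)
    rcases lt_trichotomy (orient p q x) 0 with h | h | h
    · exact Or.inl (Or.inr ⟨hx, h⟩)
    · exact absurd (collinear_of_orient_eq_zero h)
        (hS p hp q hq x hx hpq (Ne.symm h1) (Ne.symm h2))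
    · exact Or.inl (Or.inl ⟨hx, h⟩)

/-- A hull vertex has at most one neighbour in the underlying graph. -/
theorem IsHullVertex.halving_unique {S : Finset Plane} (hS : InGeneralPosition S) {p q r : Plane}
    (hp : p ∈ S) (hq : q ∈ S) (hr : r ∈ S) (hv : IsHullVertex S p)
    (hpq : IsHalvingPair S p q) (hpr : IsHalvingPair S p r) : q = r := by
  classical
  by_contra hqr
  wlog h : 0 < orient p q r generalizing q r
  · refine this hr hq hpr hpq (Ne.symm hqr) ?_
    have hne : orient p q r ≠ 0 := fun h0 =>
      hS p hp q hq r hr hpq.1 hpr.1 hqr (collinear_of_orient_eq_zero h0)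
    rw [orient_swap_right]
    have := lt_of_le_of_ne (not_lt.1 h) hne
    linarith
  -- A point positive for `r` but negative for `q` would, together with `q` and `r`, surround `p`.
  -- The inclusion is strict because of `r`, yet both halving lines must have equally many positive
  -- points.
  have hsub : S.filter (fun s => 0 < orient p r s) ⊂ S.filter (fun s => 0 < orient p q s) := by
    rw [Finset.ssubset_iff_of_subset]
    · refine ⟨r, by simp [hr, h], ?_⟩
      have : orient p r r = 0 := by unfold orient; ring
      simp [this]
    · intro s hs
      obtain ⟨hs, hrs⟩ := Finset.mem_filter.1 hs
      refine Finset.mem_filter.2 ⟨hs, ?_⟩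
      by_contra hcon
      rcases (not_lt.1 hcon).lt_or_eq with hlt | heq
      · refine not_isHullVertex_of_surrounded hq hr hs h hrs ?_ hv
        rw [orient_swap_right]; linarith
      · have hps : p ≠ s := by
          rintro rfl
          have : orient p r p = 0 := by unfold orient; ring
          linarith
        have hqs : q ≠ s := by
          rintro rfl
          rw [orient_swap_right] at hrs
          linarith
        exact hS p hp q hq s hs hpq.1 hps hqs (collinear_of_orient_eq_zero heq)
  have hlt := Finset.card_lt_card hsub
  have h1 := card_pos_add_card_neg hS hp hq hpq.1
  have h2 := card_pos_add_card_neg hS hp hr hpr.1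
  have h3 := hpq.2
  have h4 := hpr.2
  omega

/-- A set of at least three points in general position has at least three hull vertices. -/
theorem exists_three_hullVertices {S : Finset Plane} (hS : InGeneralPosition S)
    (h3 : 3 ≤ S.card) : ∃ E ⊆ S, E.card = 3 ∧ ∀ x ∈ E, IsHullVertex S x := by
  classical
  set E : Finset Plane := S.filter (IsHullVertex S) with hE
  have hcoe : (E : Set Plane) = (convexHull ℝ (S : Set Plane)).extremePoints ℝ := by
    ext x
    simp only [hE, Finset.coe_filter, Set.mem_ofPred_eq]
    exact ⟨fun h => h.2, fun h => ⟨by exact_mod_cast extremePoints_convexHull_subset h, h⟩⟩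
  -- Krein–Milman; with at most two extreme points the whole set would then be collinear.
  have hhull : convexHull ℝ (E : Set Plane) = convexHull ℝ (S : Set Plane) := by
    have := closure_convexHull_extremePoints (S.finite_toSet.isCompact_convexHull (𝕜 := ℝ))
      (convex_convexHull ℝ (S : Set Plane))
    rw [← hcoe] at this
    rwa [(E.finite_toSet.isClosed_convexHull (𝕜 := ℝ)).closure_eq] at this
  have hcard : 3 ≤ E.card := by
    by_contra hlt
    have hcol : Collinear ℝ (E : Set Plane) := by
      have hle : E.card ≤ 2 := by omega
      rcases Nat.lt_or_ge E.card 2 with h | h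
      · obtain ⟨a, ha⟩ := Finset.card_le_one_iff_subset_singleton.1 (Nat.le_of_lt_succ h)
        exact (collinear_singleton ℝ a).subset (by exact_mod_cast ha)
      · obtain ⟨a, b, _, hab⟩ := Finset.card_eq_two.1 (le_antisymm hle h)
        rw [hab]
        simpa using collinear_pair ℝ a b
    have hcolS : Collinear ℝ (S : Set Plane) := by
      have h1 : (S : Set Plane) ⊆ affineSpan ℝ (E : Set Plane) := by
        refine (subset_convexHull ℝ _).trans ?_
        rw [← hhull]
        exact convexHull_subset_affineSpan _
      refine Collinear.subset h1 ?_
      rw [Collinear, ← AffineSubspace.direction_eq_vectorSpan, direction_affineSpan]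
      exact hcol
    obtain ⟨a, b, c, ha, hb, hc, hab, hac, hbc⟩ := Finset.two_lt_card_iff.1 h3
    refine hS a ha b hb c hc hab hac hbc (hcolS.subset ?_)
    intro x hx
    rcases hx with rfl | rfl | rfl <;> assumption
  obtain ⟨F, hF, hFc⟩ := Finset.exists_subset_card_eq hcard
  exact ⟨F, hF.trans (Finset.filter_subset _ _), hFc, fun x hx => (Finset.mem_filter.1 (hF hx)).2⟩

/-- Rotating the cycle to start at `w` exhibits two distinct neighbours of `w`: its second and its
penultimate vertex. -/
theorem not_isHullVertex_of_mem_cycle {S : Finset Plane} (hS : InGeneralPosition S)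
    {v : S} {c : (underlyingGraph S).Walk v v} (hc : c.IsCycle) {w : S} (hw : w ∈ c.support) :
    ¬ IsHullVertex S w := by
  classical
  intro hv
  have hc' := hc.rotate hw
  have h1 : (underlyingGraph S).Adj w (c.rotate w hw).snd := (c.rotate w hw).adj_snd hc'.not_nil
  have h2 : (underlyingGraph S).Adj (c.rotate w hw).penultimate w :=
    (c.rotate w hw).adj_penultimate hc'.not_nil
  exact hc'.snd_ne_penultimate (Subtype.ext
    (hv.halving_unique hS w.2 (c.rotate w hw).snd.2 (c.rotate w hw).penultimate.2 h1 h2.symm))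

theorem cycle_length_add_three_le {S : Finset Plane} (hS : InGeneralPosition S)
    {v : S} {c : (underlyingGraph S).Walk v v} (hc : c.IsCycle) : c.length + 3 ≤ S.card := by
  classical
  -- The support lists the base vertex twice; its tail lists each vertex once.
  set T : Finset Plane := c.support.tail.toFinset.map (Function.Embedding.subtype _) with hT
  have hTS : T ⊆ S := by
    intro x hx
    obtain ⟨y, _, rfl⟩ := Finset.mem_map.1 hx
    exact y.2
  have hTc : T.card = c.length := by
    rw [hT, Finset.card_map, List.toFinset_card_of_nodup hc.support_nodup]
    simp
  obtain ⟨E, hES, hEc, hE⟩ := exists_three_hullVertices hS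
    (hc.three_le_length.trans (hTc ▸ Finset.card_le_card hTS))
  have hdisj : Disjoint T E := by
    rw [Finset.disjoint_left]
    intro x hx hxE
    obtain ⟨y, hy, rfl⟩ := Finset.mem_map.1 hx
    exact not_isHullVertex_of_mem_cycle hS hc (List.mem_of_mem_tail (List.mem_toFinset.1 hy))
      (hE _ hxE)
  rw [← hTc, ← hEc, ← Finset.card_union_of_disjoint hdisj]
  exact Finset.card_le_card (Finset.union_subset hTS hES)

/-! ### Signs of quadratic polynomials near zero -/

theorem eventually_sign_eq {f : ℝ → ℝ} (hf : Continuous f) {c : ℝ} (h0 : f 0 = c) (hc : c ≠ 0) :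
    ∀ᶠ ε in 𝓝[>] (0 : ℝ), SignType.sign (f ε) = SignType.sign c := by
  have ht : Tendsto f (𝓝[>] 0) (𝓝 c) := h0 ▸ hf.continuousAt.tendsto.mono_left nhdsWithin_le_nhds
  rcases hc.lt_or_gt with h | h
  · filter_upwards [ht.eventually_lt_const h] with ε hε
    rw [sign_neg h, sign_neg hε]
  · filter_upwards [ht.eventually_const_lt h] with ε hε
    rw [sign_pos h, sign_pos hε]

theorem eventually_sign_of_const_ne_zero {c₀ : ℝ} (c₁ c₂ : ℝ) (h : c₀ ≠ 0) :
    ∀ᶠ ε in 𝓝[>] (0 : ℝ), SignType.sign (c₀ + c₁ * ε + c₂ * ε ^ 2) = SignType.sign c₀ :=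
  eventually_sign_eq (by fun_prop) (by simp) h

theorem eventually_sign_of_linear_ne_zero {c₁ : ℝ} (c₂ : ℝ) (h : c₁ ≠ 0) :
    ∀ᶠ ε in 𝓝[>] (0 : ℝ), SignType.sign (0 + c₁ * ε + c₂ * ε ^ 2) = SignType.sign c₁ := by
  filter_upwards [eventually_sign_eq (f := fun ε => c₁ + c₂ * ε) (by fun_prop) (by simp) h,
    self_mem_nhdsWithin] with ε hε hpos
  rw [← hε, show 0 + c₁ * ε + c₂ * ε ^ 2 = ε * (c₁ + c₂ * ε) by ring, sign_mul,
    sign_pos (Set.mem_Ioi.1 hpos), one_mul]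

/-! ### The three-armed configuration and its orientation coefficients -/

/-- Labels of the points: an arm, and in it a point of the inner cluster (`inl`) or of the outer
chain (`inr`). -/
abbrev StarLabel (k : ℕ) : Type := Fin 3 × (Fin k ⊕ Fin k)

namespace Star

/-- The arm directions sum to zero, and the side vector of arm `i` is the direction of arm `i + 1`
minus that of arm `i + 2`. A linear map permutes the arms cyclically, so the formulas below depend
on `i` only through `shift`. -/
def dirX : Fin 3 → ℝ := ![1, 0, -1]
def dirY : Fin 3 → ℝ := ![0, 1, -1]
def sideX : Fin 3 → ℝ := ![1, -2, 1]
def sideY : Fin 3 → ℝ := ![2, -1, -1]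

variable {k : ℕ}

/-- Limit distance from the centre. -/
noncomputable def radial : Fin k ⊕ Fin k → ℝ :=
  Sum.elim (fun _ => 1) (fun j => 1 + ((j : ℝ) + 1) / k)

/-- First-order lateral displacement. -/
noncomputable def height : Fin k ⊕ Fin k → ℝ :=
  Sum.elim (fun a => (a : ℝ)) (fun j => -(((j : ℝ) + 1) / k) ^ 2)

/-- First-order radial displacement. -/
noncomputable def shift (i : Fin 3) : Fin k ⊕ Fin k → ℝ :=
  Sum.elim (fun a => (a : ℝ) ^ 2 / (2 * k) - if i = 0 ∧ (a : ℕ) = 0 then 4 * (k : ℝ) else 0)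
    (fun _ => 0)

noncomputable def limX (l : StarLabel k) : ℝ := radial l.2 * dirX l.1
noncomputable def limY (l : StarLabel k) : ℝ := radial l.2 * dirY l.1
noncomputable def dispX (l : StarLabel k) : ℝ := shift l.1 l.2 * dirX l.1 + height l.2 * sideX l.1
noncomputable def dispY (l : StarLabel k) : ℝ := shift l.1 l.2 * dirY l.1 + height l.2 * sideY l.1

/-- The point with a given label; the arms become straight as `ε` tends to `0`. -/
noncomputable def point (ε : ℝ) (l : StarLabel k) : Plane :=
  !₂[limX l + ε * dispX l, limY l + ε * dispY l]

def cross {ι : Type*} (f g : ι → ℝ) (p q r : ι) : ℝ :=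
  (f q - f p) * (g r - g p) - (g q - g p) * (f r - f p)

theorem orient_point (ε : ℝ) (p q r : StarLabel k) :
    orient (point ε p) (point ε q) (point ε r) = cross limX limY p q r +
      (cross limX dispY p q r + cross dispX limY p q r) * ε + cross dispX dispY p q r * ε ^ 2 := by
  simp [orient, point, cross]
  ring

theorem eventually_sign_orient_of_lim {p q r : StarLabel k} {c : ℝ}
    (h : cross limX limY p q r = c) (hc : c ≠ 0) :
    ∀ᶠ ε in 𝓝[>] (0 : ℝ), SignType.sign (orient (point ε p) (point ε q) (point ε r)) =
      SignType.sign c := by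
  simp only [orient_point, h]
  exact eventually_sign_of_const_ne_zero _ _ hc

theorem eventually_sign_orient_of_disp {p q r : StarLabel k} {c : ℝ}
    (h₀ : cross limX limY p q r = 0) (h : cross limX dispY p q r + cross dispX limY p q r = c)
    (hc : c ≠ 0) :
    ∀ᶠ ε in 𝓝[>] (0 : ℝ), SignType.sign (orient (point ε p) (point ε q) (point ε r)) =
      SignType.sign c := by
  simp only [orient_point, h, h₀]
  exact eventually_sign_of_linear_ne_zero _ hc

theorem eventually_ne_zero_of_sign {f : ℝ → ℝ} {c : ℝ} (hc : c ≠ 0)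
    (h : ∀ᶠ ε in 𝓝[>] (0 : ℝ), SignType.sign (f ε) = SignType.sign c) :
    ∀ᶠ ε in 𝓝[>] (0 : ℝ), f ε ≠ 0 := by
  filter_upwards [h] with ε hε h0
  rw [h0, sign_zero, eq_comm, sign_eq_zero_iff] at hε
  exact hc hε

section Cross

variable (i : Fin 3) (a b c : Fin k ⊕ Fin k)

theorem cross_lim_same : cross limX limY (i, a) (i, b) (i, c) = 0 := by
  fin_cases i <;> simp [cross, limX, limY, dirX, dirY]

theorem cross_lim_next : cross limX limY (i, a) (i, b) (i + 1, c) =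
    (radial b - radial a) * radial c := by
  fin_cases i <;> simp [cross, limX, limY, dirX, dirY] <;> ring

theorem cross_lim_prev : cross limX limY (i, a) (i, b) (i + 2, c) =
    -((radial b - radial a) * radial c) := by
  fin_cases i <;> simp [cross, limX, limY, dirX, dirY] <;> ring

theorem cross_lim_distinct : cross limX limY (i, a) (i + 1, b) (i + 2, c) =
    radial a * radial b + radial b * radial c + radial c * radial a := by
  fin_cases i <;> simp [cross, limX, limY, dirX, dirY] <;> ring

theorem cross_lim_side : cross limX limY (i, a) (i + 1, b) (i, c) =
    radial b * (radial a - radial c) := by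
  fin_cases i <;> simp [cross, limX, limY, dirX, dirY] <;> ring

theorem cross_lim_side' : cross limX limY (i, a) (i + 1, b) (i + 1, c) =
    radial a * (radial b - radial c) := by
  fin_cases i <;> simp [cross, limX, limY, dirX, dirY] <;> ring

theorem cross_disp_same :
    cross limX dispY (i, a) (i, b) (i, c) + cross dispX limY (i, a) (i, b) (i, c) =
      2 * cross radial height a b c := by
  fin_cases i <;> simp [cross, limX, limY, dispX, dispY, dirX, dirY, sideX, sideY] <;> ring

theorem cross_disp_disp_same : cross dispX dispY (i, a) (i, b) (i, c) =
    2 * cross (shift i) height a b c := by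
  fin_cases i <;> simp [cross, dispX, dispY, dirX, dirY, sideX, sideY] <;> ring

variable (a b : Fin k)

/-- Inner points share the limit radius 1, so the limit coefficient vanishes; this first-order term
decides the order in which a cluster is seen from a neighbouring arm. -/
theorem cross_disp_next :
    cross limX dispY (i, .inl a) (i, .inl b) (i + 1, c) +
      cross dispX limY (i, .inl a) (i, .inl b) (i + 1, c) =
      radial c * (shift i (.inl b) - shift i (.inl a)) + (radial c + 2) * ((b : ℝ) - a) := by
  fin_cases i <;> simp [cross, limX, limY, dispX, dispY, dirX, dirY, sideX, sideY, radial, height]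
    <;> ring

theorem cross_disp_prev :
    cross limX dispY (i, .inl a) (i, .inl b) (i + 2, c) +
      cross dispX limY (i, .inl a) (i, .inl b) (i + 2, c) =
      -radial c * (shift i (.inl b) - shift i (.inl a)) + (radial c + 2) * ((b : ℝ) - a) := by
  fin_cases i <;> simp [cross, limX, limY, dispX, dispY, dirX, dirY, sideX, sideY, radial, height]
    <;> ring

variable (c : Fin k)

theorem cross_disp_side :
    cross limX dispY (i, .inl a) (i + 1, .inl b) (i, .inl c) +
      cross dispX limY (i, .inl a) (i + 1, .inl b) (i, .inl c) =
      (shift i (.inl a) + 3 * a) - (shift i (.inl c) + 3 * c) := by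
  fin_cases i <;> simp [cross, limX, limY, dispX, dispY, dirX, dirY, sideX, sideY, radial, height]
    <;> ring

theorem cross_disp_side' :
    cross limX dispY (i, .inl a) (i + 1, .inl b) (i + 1, .inl c) +
      cross dispX limY (i, .inl a) (i + 1, .inl b) (i + 1, .inl c) =
      (shift (i + 1) (.inl b) - 3 * b) - (shift (i + 1) (.inl c) - 3 * c) := by
  fin_cases i <;> simp [cross, limX, limY, dispX, dispY, dirX, dirY, sideX, sideY, radial, height]
    <;> ring

end Cross

theorem radial_ge_one (l : Fin k ⊕ Fin k) : 1 ≤ radial l := by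
  rcases l with a | j
  · simp [radial]
  · simp only [radial, Sum.elim_inr, le_add_iff_nonneg_right]
    positivity

theorem shift_le_shift (i : Fin 3) {a b : Fin k} (h : a < b) :
    shift i (.inl a) ≤ shift i (.inl b) := by
  have hab : (a : ℝ) < b := by exact_mod_cast h
  have ha : (0 : ℝ) ≤ a := by positivity
  have hk : (0 : ℝ) < k := by exact_mod_cast a.pos
  have hb : (b : ℕ) ≠ 0 := by have : (a : ℕ) < b := h; omega
  have h1 : (a : ℝ) ^ 2 / (2 * k) ≤ (b : ℝ) ^ 2 / (2 * k) := by gcongr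
  simp only [shift, Sum.elim_inl, hb, and_false, if_false]
  split_ifs <;> linarith

/-- The slope of `a ^ 2 / (2 * k)` between two indices is `(a + b) / (2 * k) < 1`, too small to
disturb the height order seen from the previous arm. -/
theorem shift_sub_shift_lt {i : Fin 3} {a b : Fin k} (hi : ¬ (i = 0 ∧ (a : ℕ) = 0)) (h : a < b) :
    shift i (.inl b) - shift i (.inl a) < b - a := by
  have hab : (a : ℝ) < b := by exact_mod_cast h
  have hk : (0 : ℝ) < k := by exact_mod_cast a.pos
  have hbk : (b : ℝ) < k := by exact_mod_cast b.2
  have hb : (b : ℕ) ≠ 0 := by have : (a : ℕ) < b := h; omega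
  simp only [shift, Sum.elim_inl, hb, and_false, if_false, hi]
  rw [sub_zero, sub_zero, ← sub_div, div_lt_iff₀ (by positivity)]
  nlinarith

/-- The displacement `4 * k` exceeds `4 * (b - a)`, whereas reversing the view from limit distance
`X ≥ 1` only needs a ratio above `(X + 2) / X ≤ 3`. -/
theorem lt_shift_sub_shift {i : Fin 3} {a b : Fin k} (hi : i = 0 ∧ (a : ℕ) = 0) (h : a < b) :
    4 * ((b : ℝ) - a) < shift i (.inl b) - shift i (.inl a) := by
  have hk : (0 : ℝ) < k := by exact_mod_cast a.pos
  have hbk : (b : ℝ) < k := by exact_mod_cast b.2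
  have hb : (b : ℕ) ≠ 0 := by have : (a : ℕ) < b := h; omega
  simp only [shift, Sum.elim_inl, hb, and_false, if_false, hi, and_self, if_true]
  have : (0 : ℝ) ≤ (b : ℝ) ^ 2 / (2 * k) := by positivity
  simp
  linarith

/-- The order in which the inner cluster of an arm is seen from the previous arm. -/
def viewOrder (k : ℕ) (i : Fin 3) : Equiv.Perm (Fin k) :=
  if i = 0 then (finRotate k).symm else 1

end Star

/-! ### General position for small `ε` -/

namespace Star
variable {k : ℕ}

theorem radial_injOn_inr {j l : Fin k} (h : radial (.inr j : Fin k ⊕ Fin k) = radial (.inr l)) :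
    j = l := by
  have hk : (k : ℝ) ≠ 0 := by have := j.pos; positivity
  simp only [radial, Sum.elim_inr, add_right_inj] at h
  rw [div_left_inj' hk, add_left_inj] at h
  exact Fin.ext (by exact_mod_cast h)

theorem radial_inr_gt (j : Fin k) : 1 < radial (.inr j : Fin k ⊕ Fin k) := by
  have hk : (0 : ℝ) < k := by exact_mod_cast j.pos
  simp only [radial, Sum.elim_inr]
  have : (0 : ℝ) < ((j : ℝ) + 1) / k := by positivity
  linarith

/-- The product of two distinct chain parameters. -/
theorem chain_mul_mem {j l : Fin k} (h : j ≠ l) :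
    0 < (((j : ℝ) + 1) / k) * (((l : ℝ) + 1) / k) ∧
      (((j : ℝ) + 1) / k) * (((l : ℝ) + 1) / k) < 1 := by
  have hk : (0 : ℝ) < k := by exact_mod_cast j.pos
  refine ⟨by positivity, ?_⟩
  rw [div_mul_div_comm, div_lt_one (by positivity)]
  have h1 : (j : ℕ) ≠ l := fun h' => h (Fin.ext h')
  have h2 : ((j : ℕ) + 1) * ((l : ℕ) + 1) < k * k := by
    have hj := j.2
    have hl := l.2
    rcases h1.lt_or_gt with h1 | h1
    · exact Nat.mul_lt_mul_of_lt_of_le (by omega) (by omega) (by omega)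
    · exact Nat.mul_lt_mul_of_le_of_lt (by omega) (by omega) (by omega)
  exact_mod_cast h2

theorem natCast_ne_chain_mul {j l : Fin k} (h : j ≠ l) (c : ℕ) :
    (c : ℝ) ≠ (((j : ℝ) + 1) / k) * (((l : ℝ) + 1) / k) := by
  intro hc
  obtain ⟨h1, h2⟩ := chain_mul_mem h
  rw [← hc] at h1 h2
  have h1' : 0 < c := by exact_mod_cast h1
  have h2' : c < 1 := by exact_mod_cast h2
  omega

theorem cross_lll (a b c : Fin k) :
    cross (radial (k := k)) height (.inl a) (.inl b) (.inl c) = 0 := by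
  simp [cross, radial]

theorem cross_llr (a b j : Fin k) :
    cross radial height (.inl a) (.inl b) (.inr j) = -(((j : ℝ) + 1) / k) * (b - a) := by
  simp [cross, radial, height]; ring

/-- The chord of the parabola `-t ^ 2` between parameters `s` and `t` meets the cluster line `t = 0`
at height `s * t`. By `chain_mul_mem` this lies strictly between inner points 0 and 1. -/
theorem cross_rrl (j l a : Fin k) :
    cross radial height (.inr j) (.inr l) (.inl a) = (((l : ℝ) + 1) / k - ((j : ℝ) + 1) / k) *
      (a - (((j : ℝ) + 1) / k) * (((l : ℝ) + 1) / k)) := by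
  simp [cross, radial, height]; ring

theorem cross_rrr (j l m : Fin k) :
    cross radial height (.inr j) (.inr l) (.inr m) = (((l : ℝ) + 1) / k - ((j : ℝ) + 1) / k) *
      (((m : ℝ) + 1) / k - ((j : ℝ) + 1) / k) * (((l : ℝ) + 1) / k - ((m : ℝ) + 1) / k) := by
  simp [cross, radial, height]; ring

theorem chain_sub_ne_zero {j l : Fin k} (h : j ≠ l) :
    ((l : ℝ) + 1) / k - ((j : ℝ) + 1) / k ≠ 0 := by
  have hk : (k : ℝ) ≠ 0 := by have := j.pos; positivity
  rw [sub_ne_zero, Ne, div_left_inj' hk, add_left_inj]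
  exact fun h' => h (Fin.ext (by exact_mod_cast h'.symm))

theorem natCast_sub_ne_zero {a b : Fin k} (h : a ≠ b) : (b : ℝ) - a ≠ 0 := by
  rw [sub_ne_zero]
  exact fun h' => h (Fin.ext (by exact_mod_cast h'.symm))

/-- Inner points of one arm are collinear to first order, so the `ε ^ 2` coefficient must separate
them. The quadratic `shift` puts them on a parabola; if the displaced point takes part, `b * c < 8 *
k ^ 2` settles the sign. -/
theorem cross_shift_ne_zero (i : Fin 3) {a b c : Fin k} (hab : a < b) (hbc : b < c) :
    cross (shift i) height (.inl a) (.inl b) (.inl c) ≠ 0 := by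
  have hk : (0 : ℝ) < k := by exact_mod_cast a.pos
  have hab' : (0 : ℝ) < b - a := by rw [sub_pos]; exact_mod_cast hab
  have hbc' : (0 : ℝ) < c - b := by rw [sub_pos]; exact_mod_cast hbc
  have hbk : (b : ℝ) < k := by exact_mod_cast b.2
  have hck : (c : ℝ) < k := by exact_mod_cast c.2
  have ha0 : (0 : ℝ) ≤ a := by positivity
  have hb : (b : ℕ) ≠ 0 := by have : (a : ℕ) < b := hab; omega
  have hc : (c : ℕ) ≠ 0 := by have : (b : ℕ) < c := hbc; omega
  simp only [cross, shift, height, Sum.elim_inl, hb, hc, and_false, if_false, sub_zero]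
  by_cases hi : i = 0 ∧ (a : ℕ) = 0
  · have ha : (a : ℝ) = 0 := by exact_mod_cast hi.2
    simp only [hi, and_self, if_true]
    have : ((b : ℝ) ^ 2 / (2 * k) - ((0 : ℕ) ^ 2 / (2 * k) - 4 * k)) * (c - 0) -
        (b - 0) * ((c : ℝ) ^ 2 / (2 * k) - ((0 : ℕ) ^ 2 / (2 * k) - 4 * k)) =
        (c - b) * (8 * k ^ 2 - b * c) / (2 * k) := by
      field_simp
      push_cast
      ring
    simp only [CharP.cast_eq_zero] at this ⊢
    rw [this]
    have : 0 < 8 * (k : ℝ) ^ 2 - b * c := by nlinarith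
    positivity
  · simp only [hi, if_false, sub_zero]
    have : ((b : ℝ) ^ 2 / (2 * k) - (a : ℝ) ^ 2 / (2 * k)) * (c - a) -
        (b - a) * ((c : ℝ) ^ 2 / (2 * k) - (a : ℝ) ^ 2 / (2 * k)) =
        -((b - a) * (c - b) * ((c - b) + (b - a)) / (2 * k)) := by
      field_simp
      ring
    rw [this]
    exact neg_ne_zero.2 (by positivity)

/-- The three points are eventually not collinear. -/
def Generic (p q r : StarLabel k) : Prop :=
  ∀ᶠ ε in 𝓝[>] (0 : ℝ), orient (point ε p) (point ε q) (point ε r) ≠ 0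

theorem Generic.rotate {p q r : StarLabel k} (h : Generic p q r) : Generic q r p := by
  filter_upwards [h] with ε hε
  rwa [orient_rotate]

theorem Generic.swap {p q r : StarLabel k} (h : Generic p q r) : Generic q p r := by
  filter_upwards [h] with ε hε
  rwa [orient_swap, neg_ne_zero]

theorem generic_of_lim {p q r : StarLabel k} (h : cross limX limY p q r ≠ 0) : Generic p q r :=
  eventually_ne_zero_of_sign h (eventually_sign_orient_of_lim rfl h)

theorem generic_of_disp {p q r : StarLabel k} (h₀ : cross limX limY p q r = 0)
    (h : cross limX dispY p q r + cross dispX limY p q r ≠ 0) : Generic p q r :=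
  eventually_ne_zero_of_sign h (eventually_sign_orient_of_disp h₀ rfl h)

theorem generic_of_cross {i : Fin 3} {a b c : Fin k ⊕ Fin k} (h : cross radial height a b c ≠ 0) :
    Generic (i, a) (i, b) (i, c) :=
  generic_of_disp (cross_lim_same i a b c)
    (by rw [cross_disp_same]; exact mul_ne_zero two_ne_zero h)

theorem generic_lll (i : Fin 3) {a b c : Fin k} (hab : a < b) (hbc : b < c) :
    Generic (i, .inl a) (i, .inl b) (i, .inl c) := by
  filter_upwards [self_mem_nhdsWithin] with ε hε
  rw [orient_point, cross_lim_same, cross_disp_same, cross_lll, cross_disp_disp_same]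
  have := cross_shift_ne_zero i hab hbc
  have hε' : ε ≠ 0 := (Set.mem_Ioi.1 hε).ne'
  simpa [hε'] using this

theorem generic_lll' (i : Fin 3) {a b c : Fin k} (hab : a ≠ b) (hac : a ≠ c) (hbc : b ≠ c) :
    Generic (i, .inl a) (i, .inl b) (i, .inl c) := by
  rcases hab.lt_or_gt with h1 | h1 <;> rcases hbc.lt_or_gt with h2 | h2 <;>
    rcases hac.lt_or_gt with h3 | h3
  · exact generic_lll i h1 h2
  · exact absurd (h1.trans h2) h3.asymm
  · exact (generic_lll i h3 h2).swap.rotate.rotate.swap.rotate.swap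
  · exact (generic_lll i h3 h1).rotate
  · exact (generic_lll i h1 h3).swap
  · exact (generic_lll i h2 h3).rotate.rotate
  · exact absurd (h2.trans h1) h3.asymm
  · exact (generic_lll i h2 h1).swap.rotate.rotate

theorem generic_llr (i : Fin 3) {a b : Fin k} (h : a ≠ b) (j : Fin k) :
    Generic (i, .inl a) (i, .inl b) (i, .inr j) := by
  refine generic_of_cross ?_
  have hk : (0 : ℝ) < k := by exact_mod_cast j.pos
  rw [cross_llr]
  have h1 : ((j : ℝ) + 1) / k ≠ 0 := by positivity
  exact mul_ne_zero (neg_ne_zero.2 h1) (natCast_sub_ne_zero h)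

theorem generic_rrl (i : Fin 3) {j l : Fin k} (h : j ≠ l) (a : Fin k) :
    Generic (i, .inr j) (i, .inr l) (i, .inl a) := by
  refine generic_of_cross ?_
  rw [cross_rrl]
  exact mul_ne_zero (chain_sub_ne_zero h) (sub_ne_zero.2 (natCast_ne_chain_mul h a))

theorem generic_same_arm (i : Fin 3) {a b c : Fin k ⊕ Fin k} (hab : a ≠ b) (hac : a ≠ c)
    (hbc : b ≠ c) : Generic (i, a) (i, b) (i, c) := by
  rcases a with a | a <;> rcases b with b | b <;> rcases c with c | c <;>
    simp only [ne_eq, Sum.inl.injEq, Sum.inr.injEq] at hab hac hbc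
  · exact generic_lll' i hab hac hbc
  · exact generic_llr i hab c
  · exact (generic_llr i hac b).swap.rotate
  · exact (generic_rrl i hbc a).rotate.rotate
  · exact (generic_llr i hbc a).rotate.rotate
  · exact (generic_rrl i hac b).swap.rotate
  · exact generic_rrl i hab c
  · refine generic_of_cross ?_
    rw [cross_rrr]
    exact mul_ne_zero (mul_ne_zero (chain_sub_ne_zero hab) (chain_sub_ne_zero hac))
      (chain_sub_ne_zero (Ne.symm hbc))

theorem view_next_pos (i : Fin 3) {a b : Fin k} (h : a < b) {X : ℝ} (hX : 1 ≤ X) :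
    0 < X * (shift i (.inl b) - shift i (.inl a)) + (X + 2) * ((b : ℝ) - a) := by
  have h1 := shift_le_shift i h
  have h2 : (0 : ℝ) < b - a := by rw [sub_pos]; exact_mod_cast h
  have := mul_nonneg (zero_le_one.trans hX) (sub_nonneg.2 h1)
  have : 0 < (X + 2) * ((b : ℝ) - a) := by positivity
  linarith

theorem view_prev_pos {i : Fin 3} {a b : Fin k} (hi : ¬ (i = 0 ∧ (a : ℕ) = 0)) (h : a < b) {X : ℝ}
    (hX : 1 ≤ X) :
    0 < -X * (shift i (.inl b) - shift i (.inl a)) + (X + 2) * ((b : ℝ) - a) := by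
  have h1 := shift_sub_shift_lt hi h
  have h2 : (0 : ℝ) < b - a := by rw [sub_pos]; exact_mod_cast h
  nlinarith

theorem view_prev_neg {i : Fin 3} {a b : Fin k} (hi : i = 0 ∧ (a : ℕ) = 0) (h : a < b) {X : ℝ}
    (hX : 1 ≤ X) :
    -X * (shift i (.inl b) - shift i (.inl a)) + (X + 2) * ((b : ℝ) - a) < 0 := by
  have h1 := lt_shift_sub_shift hi h
  have h2 : (0 : ℝ) < b - a := by rw [sub_pos]; exact_mod_cast h
  nlinarith

theorem fin_three_cases (i j : Fin 3) : j = i ∨ j = i + 1 ∨ j = i + 2 := by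
  revert i j; decide

/-- Different radii decide already in the limit. Equal radii force two inner points, which the view
from the third point orders strictly. -/
theorem generic_two_same_arm {i j : Fin 3} (hij : j ≠ i) {a b : Fin k ⊕ Fin k} (hab : a ≠ b)
    (c : Fin k ⊕ Fin k) : Generic (i, a) (i, b) (j, c) := by
  have hc := radial_ge_one c
  have hj : j = i + 1 ∨ j = i + 2 := (fin_three_cases i j).resolve_left hij
  by_cases hr : radial a = radial b
  · obtain ⟨a, rfl⟩ : ∃ a', a = .inl a' := by
      rcases a with a | a
      · exact ⟨a, rfl⟩
      · rcases b with b | b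
        · exact absurd hr (radial_inr_gt a).ne'
        · exact absurd (congrArg _ (radial_injOn_inr hr)) hab
    obtain ⟨b, rfl⟩ : ∃ b', b = .inl b' := by
      rcases b with b | b
      · exact ⟨b, rfl⟩
      · exact absurd hr (radial_inr_gt b).ne
    wlog hlt : a < b generalizing a b
    · refine (this b a (Ne.symm hab) hr.symm ?_).swap
      exact lt_of_le_of_ne (not_lt.1 hlt) fun h => hab (congrArg _ h.symm)
    rcases hj with rfl | rfl
    · refine generic_of_disp (by rw [cross_lim_next, hr]; simp) ?_
      rw [cross_disp_next]
      exact (view_next_pos i hlt hc).ne'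
    · refine generic_of_disp (by rw [cross_lim_prev, hr]; simp) ?_
      rw [cross_disp_prev]
      by_cases hi : i = 0 ∧ (a : ℕ) = 0
      · exact (view_prev_neg hi hlt hc).ne
      · exact (view_prev_pos hi hlt hc).ne'
  · have hne : (radial b - radial a) * radial c ≠ 0 :=
      mul_ne_zero (sub_ne_zero.2 (Ne.symm hr)) (by linarith)
    rcases hj with rfl | rfl
    · exact generic_of_lim (by rwa [cross_lim_next])
    · exact generic_of_lim (by rw [cross_lim_prev]; exact neg_ne_zero.2 hne)

theorem generic_distinct_arms (i : Fin 3) (a b c : Fin k ⊕ Fin k) :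
    Generic (i, a) (i + 1, b) (i + 2, c) := by
  refine generic_of_lim ?_
  rw [cross_lim_distinct]
  have := radial_ge_one a
  have := radial_ge_one b
  have := radial_ge_one c
  positivity

theorem generic_of_ne {p q r : StarLabel k} (hpq : p ≠ q) (hpr : p ≠ r) (hqr : q ≠ r) :
    Generic p q r := by
  obtain ⟨i, a⟩ := p
  obtain ⟨j, b⟩ := q
  obtain ⟨m, c⟩ := r
  by_cases hij : i = j
  · subst hij
    have hab : a ≠ b := fun h => hpq (by rw [h])
    by_cases him : m = i
    · subst him
      exact generic_same_arm m hab (fun h => hpr (by rw [h])) (fun h => hqr (by rw [h]))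
    · exact generic_two_same_arm him hab c
  by_cases him : i = m
  · subst him
    exact (generic_two_same_arm (Ne.symm hij) (fun h => hpr (by rw [h])) b).swap.rotate
  by_cases hjm : j = m
  · subst hjm
    exact (generic_two_same_arm hij (fun h => hqr (by rw [h])) a).rotate.rotate
  rcases (fin_three_cases i j).resolve_left (Ne.symm hij) with rfl | rfl <;>
    rcases (fin_three_cases i m).resolve_left (Ne.symm him) with rfl | rfl
  · exact absurd rfl hjm
  · exact generic_distinct_arms i a b c
  · exact (generic_distinct_arms i a c b).swap.rotate
  · exact absurd rfl hjm

end Star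

/-! ### Halving edges of the configuration -/

namespace Star
variable {k : ℕ}

/-- Points on the positive side of the line through `p` and `q`, minus those on the negative. -/
noncomputable def imbalance (ε : ℝ) (p q : StarLabel k) : ℤ :=
  ∑ r : StarLabel k, (SignType.sign (orient (point ε p) (point ε q) (point ε r)) : ℤ)

def IsEdge (p q : StarLabel k) : Prop := p ≠ q ∧ ∀ᶠ ε in 𝓝[>] (0 : ℝ), imbalance ε p q = 0

/-- The signed side of `r` with respect to `p` and `q` is eventually `s`. -/
def HasSide (p q r : StarLabel k) (s : ℤ) : Prop :=
  ∀ᶠ ε in 𝓝[>] (0 : ℝ),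
    (SignType.sign (orient (point ε p) (point ε q) (point ε r)) : ℤ) = s

theorem IsEdge.symm {p q : StarLabel k} (h : IsEdge p q) : IsEdge q p := by
  refine ⟨h.1.symm, ?_⟩
  filter_upwards [h.2] with ε hε
  unfold imbalance at hε ⊢
  simp only [orient_swap (point ε p), Left.sign_neg]
  simpa using hε

theorem hasSide_left (p q : StarLabel k) : HasSide p q p 0 := by
  refine Eventually.of_forall fun ε => ?_
  simp [orient]

theorem hasSide_right (p q : StarLabel k) : HasSide p q q 0 := by
  refine Eventually.of_forall fun ε => ?_
  rw [show orient (point ε p) (point ε q) (point ε q) = 0 by unfold orient; ring]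
  simp

theorem hasSide_one_of_lim {p q r : StarLabel k} (h : 0 < cross limX limY p q r) :
    HasSide p q r 1 := by
  filter_upwards [eventually_sign_orient_of_lim rfl h.ne'] with ε hε
  simp [hε, sign_pos h]

theorem hasSide_neg_one_of_lim {p q r : StarLabel k} (h : cross limX limY p q r < 0) :
    HasSide p q r (-1) := by
  filter_upwards [eventually_sign_orient_of_lim rfl h.ne] with ε hε
  simp [hε, sign_neg h]

theorem hasSide_one_of_disp {p q r : StarLabel k} (h₀ : cross limX limY p q r = 0)
    (h : 0 < cross limX dispY p q r + cross dispX limY p q r) : HasSide p q r 1 := by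
  filter_upwards [eventually_sign_orient_of_disp h₀ rfl h.ne'] with ε hε
  simp [hε, sign_pos h]

theorem hasSide_neg_one_of_disp {p q r : StarLabel k} (h₀ : cross limX limY p q r = 0)
    (h : cross limX dispY p q r + cross dispX limY p q r < 0) : HasSide p q r (-1) := by
  filter_upwards [eventually_sign_orient_of_disp h₀ rfl h.ne] with ε hε
  simp [hε, sign_neg h]

theorem sum_fin_three_rotate (i : Fin 3) (f : Fin 3 → ℤ) :
    ∑ j, f j = f i + f (i + 1) + f (i + 2) := by
  rw [← Equiv.sum_comp (Equiv.addLeft i) f, Fin.sum_univ_three]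
  simp

theorem isEdge_of_hasSide {p q : StarLabel k} (hpq : p ≠ q) (i : Fin 3)
    {s₀ s₁ s₂ : Fin k ⊕ Fin k → ℤ}
    (h₀ : ∀ l, HasSide p q (i, l) (s₀ l)) (h₁ : ∀ l, HasSide p q (i + 1, l) (s₁ l))
    (h₂ : ∀ l, HasSide p q (i + 2, l) (s₂ l))
    (hs : ∑ l, s₀ l + ∑ l, s₁ l + ∑ l, s₂ l = 0) : IsEdge p q := by
  refine ⟨hpq, ?_⟩
  filter_upwards [eventually_all.2 h₀, eventually_all.2 h₁, eventually_all.2 h₂] with ε e₀ e₁ e₂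
  rw [imbalance, Fintype.sum_prod_type, sum_fin_three_rotate i]
  simp only [e₀, e₁, e₂, hs]

theorem isEdge_same_arm (i : Fin 3) {a b : Fin k ⊕ Fin k} (hab : radial a < radial b)
    {s : Fin k ⊕ Fin k → ℤ} (hs : ∀ l, l = a ∧ s l = 0 ∨ l = b ∧ s l = 0 ∨
      0 < cross radial height a b l ∧ s l = 1 ∨ cross radial height a b l < 0 ∧ s l = -1)
    (hsum : ∑ l, s l = 0) : IsEdge (i, a) (i, b) := by
  have hpos : ∀ l : Fin k ⊕ Fin k, 0 < (radial b - radial a) * radial l := fun l =>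
    mul_pos (sub_pos.2 hab) (zero_lt_one.trans_le (radial_ge_one l))
  have hne : (i, a) ≠ (i, b) := fun h => hab.ne (congrArg (fun l => radial l.2) h)
  refine isEdge_of_hasSide hne i (s₀ := s) (s₁ := fun _ => 1) (s₂ := fun _ => -1) (fun l => ?_)
    (fun l => hasSide_one_of_lim (by rw [cross_lim_next]; exact hpos l))
    (fun l => hasSide_neg_one_of_lim (by rw [cross_lim_prev]; exact neg_neg_of_pos (hpos l)))
    (by simp [hsum])
  rcases hs l with ⟨rfl, h⟩ | ⟨rfl, h⟩ | ⟨h, h'⟩ | ⟨h, h'⟩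
  · rw [h]; exact hasSide_left _ _
  · rw [h]; exact hasSide_right _ _
  · rw [h']
    exact hasSide_one_of_disp (cross_lim_same _ _ _ _) (by rw [cross_disp_same]; linarith)
  · rw [h']
    exact hasSide_neg_one_of_disp (cross_lim_same _ _ _ _) (by rw [cross_disp_same]; linarith)

/-- The inverse rotation keeps the order except that 0 becomes last. -/
theorem lt_of_finRotate_symm_lt {b c : Fin k} (h : (finRotate k).symm b < (finRotate k).symm c) :
    (b < c ∧ (b : ℕ) ≠ 0) ∨ ((c : ℕ) = 0 ∧ c < b) := by
  obtain ⟨b, rfl⟩ := (finRotate k).surjective b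
  obtain ⟨c, rfl⟩ := (finRotate k).surjective c
  rw [Equiv.symm_apply_apply, Equiv.symm_apply_apply] at h
  obtain _ | n := k
  · exact b.elim0
  have hb : b ≠ Fin.last n := (h.trans_le (Fin.le_last c)).ne
  have hb' := coe_finRotate_of_ne_last hb
  have h' : (b : ℕ) < c := h
  simp only [Fin.lt_def, hb']
  by_cases hc : c = Fin.last n
  · subst hc
    rw [finRotate_last]
    right
    simp
  · rw [coe_finRotate_of_ne_last hc]
    omega

theorem lt_of_viewOrder_lt (i : Fin 3) {b c : Fin k} (h : viewOrder k i b < viewOrder k i c) :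
    shift i (.inl c) - 3 * c < shift i (.inl b) - 3 * (b : ℝ) := by
  by_cases hi : i = 0
  · rw [viewOrder, if_pos hi] at h
    rcases lt_of_finRotate_symm_lt h with ⟨hbc, hb⟩ | ⟨hc, hcb⟩
    · have := view_prev_pos (i := i) (fun h => hb h.2) hbc le_rfl
      linarith
    · have := view_prev_neg ⟨hi, hc⟩ hcb le_rfl
      linarith
  · rw [viewOrder, if_neg hi] at h
    have := view_prev_pos (i := i) (fun h => hi h.1) (show b < c from h) le_rfl
    linarith

/-- The third arm puts `2 * k` points on the positive side, the two chains `2 * k` on the negative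
side. The two clusters are split in opposite senses, and equal ranks make them cancel. -/
theorem isEdge_next_arm (i : Fin 3) {a b : Fin k} (hab : viewOrder k (i + 1) b = a) :
    IsEdge (i, .inl a) (i + 1, .inl b) := by
  -- `o` is the side by rank; the second cluster contributes `-o` reindexed by a permutation, so the
  -- sums cancel.
  set o : Fin k → ℤ := fun c => if c < a then 1 else if a < c then -1 else 0 with ho
  have hr : ∀ l : Fin k ⊕ Fin k, 0 < radial l := fun l => zero_lt_one.trans_le (radial_ge_one l)
  have hne : i ≠ i + 1 := by fin_cases i <;> decide
  refine isEdge_of_hasSide (fun h => hne (congrArg Prod.fst h)) i (s₀ := Sum.elim o fun _ => -1)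
    (s₁ := Sum.elim (fun c => -o (viewOrder k (i + 1) c)) fun _ => -1) (s₂ := fun _ => 1) ?_ ?_ ?_ ?_
  · rintro (c | j)
    · have h0 : cross limX limY (i, .inl a) (i + 1, .inl b) (i, .inl c) = 0 := by
        rw [cross_lim_side]; simp [radial]
      rcases lt_trichotomy c a with h | rfl | h
      · simp only [Sum.elim_inl, ho, h, if_true]
        refine hasSide_one_of_disp h0 ?_
        rw [cross_disp_side]
        have := view_next_pos i h le_rfl
        linarith
      · simpa [ho] using hasSide_left _ _
      · simp only [Sum.elim_inl, ho, h, h.not_gt, if_true, if_false]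
        refine hasSide_neg_one_of_disp h0 ?_
        rw [cross_disp_side]
        have := view_next_pos i h le_rfl
        linarith
    · refine hasSide_neg_one_of_lim ?_
      rw [cross_lim_side]
      exact mul_neg_of_pos_of_neg (hr _) (sub_neg.2 (radial_inr_gt j))
  · rintro (c | j)
    · have h0 : cross limX limY (i, .inl a) (i + 1, .inl b) (i + 1, .inl c) = 0 := by
        rw [cross_lim_side']; simp [radial]
      rcases lt_trichotomy (viewOrder k (i + 1) c) a with h | h | h
      · simp only [Sum.elim_inl, ho, h, if_true]
        refine hasSide_neg_one_of_disp h0 ?_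
        rw [cross_disp_side']
        rw [← hab] at h
        linarith [lt_of_viewOrder_lt _ h]
      · obtain rfl : c = b := (viewOrder k (i + 1)).injective (h.trans hab.symm)
        simpa [ho, hab] using hasSide_right _ _
      · simp only [Sum.elim_inl, ho, h, h.not_gt, if_true, if_false, neg_neg]
        refine hasSide_one_of_disp h0 ?_
        rw [cross_disp_side']
        rw [← hab] at h
        linarith [lt_of_viewOrder_lt _ h]
    · refine hasSide_neg_one_of_lim ?_
      rw [cross_lim_side']
      exact mul_neg_of_pos_of_neg (hr _) (sub_neg.2 (radial_inr_gt j))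
  · intro l
    refine hasSide_one_of_lim ?_
    rw [cross_lim_distinct]
    have := hr l
    have := hr (.inl a)
    have := hr (.inl b)
    positivity
  · simp only [Fintype.sum_sum_type, Sum.elim_inl, Sum.elim_inr, Finset.sum_neg_distrib,
      Equiv.sum_comp]
    simp
    ring

theorem sum_ite_val_eq {m : ℕ} (hm : m < k) :
    ∑ c : Fin k, (if (c : ℕ) = m then (1 : ℤ) else 0) = 1 := by
  have : ∀ c : Fin k, (c : ℕ) = m ↔ c = ⟨m, hm⟩ := fun c => by simp [Fin.ext_iff]
  simp [this]

theorem chain_lt_chain {j l : Fin k} (h : j < l) :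
    0 < ((l : ℝ) + 1) / k - ((j : ℝ) + 1) / k := by
  have hk : (0 : ℝ) < k := by exact_mod_cast j.pos
  have : (j : ℝ) < l := by exact_mod_cast h
  rw [← sub_div]
  apply div_pos _ hk
  linarith

theorem radial_inr_lt {j l : Fin k} (h : j < l) :
    radial (.inr j : Fin k ⊕ Fin k) < radial (.inr l) := by
  have := chain_lt_chain h
  simp only [radial, Sum.elim_inr]
  linarith

/-- The chord cuts off inner point 0 from the other inner points. Being consecutive on a concave
curve, its ends leave the other `k - 2` chain points on the side of inner point 0: `k - 1` points
each. -/
theorem isEdge_chain (i : Fin 3) {j l : Fin k} (h : (l : ℕ) = j + 1) :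
    IsEdge (i, .inr j) (i, .inr l) := by
  have hjl : j < l := by rw [Fin.lt_def]; omega
  refine isEdge_same_arm i (radial_inr_lt hjl)
    (s := Sum.elim (fun c => 1 - 2 * if (c : ℕ) = 0 then 1 else 0)
      (fun c => -1 + ((if (c : ℕ) = j then 1 else 0) + if (c : ℕ) = l then 1 else 0))) ?_ ?_
  · obtain ⟨h1, h2⟩ := chain_mul_mem hjl.ne
    have h3 := chain_lt_chain hjl
    rintro (c | c)
    · right; right
      rw [cross_rrl]
      by_cases hc : (c : ℕ) = 0
      · right
        refine ⟨mul_neg_of_pos_of_neg h3 ?_, by simp [hc]⟩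
        rw [hc]; simpa using h1
      · left
        refine ⟨mul_pos h3 ?_, by simp [hc]⟩
        have : (1 : ℝ) ≤ (c : ℕ) := by exact_mod_cast Nat.one_le_iff_ne_zero.2 hc
        linarith
    · rw [cross_rrr]
      rcases lt_trichotomy c j with hc | rfl | hc
      · right; right; right
        have h4 := chain_lt_chain hc
        have h5 := chain_lt_chain (hc.trans hjl)
        refine ⟨mul_neg_of_neg_of_pos (mul_neg_of_pos_of_neg h3 (by linarith)) h5, ?_⟩
        have : (c : ℕ) < j := hc
        rw [Sum.elim_inr, if_neg (by omega), if_neg (by omega)]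
        norm_num
      · left
        refine ⟨rfl, ?_⟩
        rw [Sum.elim_inr, if_pos rfl, if_neg (by omega)]
        norm_num
      · right
        have hc' : (j : ℕ) < c := hc
        by_cases hcl : c = l
        · left
          subst hcl
          refine ⟨rfl, ?_⟩
          rw [Sum.elim_inr, if_neg (by omega), if_pos rfl]
          norm_num
        · right; right
          have hcl' : (c : ℕ) ≠ l := fun h => hcl (Fin.ext h)
          have h4 := chain_lt_chain hc
          have h5 := chain_lt_chain (show l < c by rw [Fin.lt_def]; omega)
          refine ⟨mul_neg_of_pos_of_neg (mul_pos h3 h4) (by linarith), ?_⟩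
          rw [Sum.elim_inr, if_neg (by omega), if_neg (by omega)]
          norm_num
  · simp only [Fintype.sum_sum_type, Sum.elim_inl, Sum.elim_inr, Finset.sum_sub_distrib,
      Finset.sum_add_distrib, ← Finset.mul_sum, sum_ite_val_eq j.pos, sum_ite_val_eq j.2,
      sum_ite_val_eq l.2]
    simp

theorem cross_lrl (a j c : Fin k) :
    cross radial height (.inl a) (.inr j) (.inl c) = (((j : ℝ) + 1) / k) * (c - a) := by
  simp [cross, radial, height]

theorem cross_lrr (a j c : Fin k) :
    cross radial height (.inl a) (.inr j) (.inr c) = (((j : ℝ) + 1) / k - ((c : ℝ) + 1) / k) *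
      ((((j : ℝ) + 1) / k) * (((c : ℝ) + 1) / k) - a) := by
  simp [cross, radial, height]; ring

/-- Inner point 0 is the point `t = 0` of the parabola, so this is again a chord between neighbours,
with the rest of the cluster on one side and the rest of the chain on the other. -/
theorem isEdge_first (i : Fin 3) {a j : Fin k} (ha : (a : ℕ) = 0) (hj : (j : ℕ) = 0) :
    IsEdge (i, .inl a) (i, .inr j) := by
  have hk : (0 : ℝ) < k := by exact_mod_cast a.pos
  refine isEdge_same_arm i (radial_inr_gt j)
    (s := Sum.elim (fun c => 1 - if (c : ℕ) = 0 then 1 else 0)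
      (fun c => -1 + if (c : ℕ) = 0 then 1 else 0)) ?_ ?_
  · rintro (c | c)
    · by_cases hc : (c : ℕ) = 0
      · exact Or.inl ⟨congrArg _ (Fin.ext (hc.trans ha.symm)), by simp [hc]⟩
      · right; right; left
        rw [cross_lrl, ha]
        have : (0 : ℝ) < (c : ℕ) := by exact_mod_cast Nat.pos_of_ne_zero hc
        exact ⟨mul_pos (by positivity) (by simpa using this), by simp [hc]⟩
    · by_cases hc : (c : ℕ) = 0
      · exact Or.inr (Or.inl ⟨congrArg _ (Fin.ext (hc.trans hj.symm)), by simp [hc]⟩)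
      · right; right; right
        have h1 := chain_lt_chain (show j < c by rw [Fin.lt_def]; omega)
        rw [cross_lrr, ha]
        refine ⟨mul_neg_of_neg_of_pos (by linarith) ?_, by simp [hc]⟩
        simp only [Nat.cast_zero, sub_zero]
        positivity
  · simp only [Fintype.sum_sum_type, Sum.elim_inl, Sum.elim_inr, Finset.sum_sub_distrib,
      Finset.sum_add_distrib, sum_ite_val_eq j.pos]
    simp

/-- The tangent to the parabola from inner point 1 touches it at `t = 1`, the outermost chain point.
Hence the line to the penultimate chain point has that point and the later inner points on one side,
inner point 0 and the remaining chain on the other. -/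
theorem isEdge_second (i : Fin 3) {a j : Fin k} (ha : (a : ℕ) = 1) (hj : (j : ℕ) + 2 = k) :
    IsEdge (i, .inl a) (i, .inr j) := by
  have hk : (0 : ℝ) < k := by exact_mod_cast a.pos
  have hak := a.2
  refine isEdge_same_arm i (radial_inr_gt j)
    (s := Sum.elim
      (fun c => 1 - (2 * (if (c : ℕ) = 0 then 1 else 0) + if (c : ℕ) = 1 then 1 else 0))
      (fun c => -1 + ((if (c : ℕ) = k - 2 then 1 else 0) +
        2 * if (c : ℕ) = k - 1 then 1 else 0))) ?_ ?_
  · rintro (c | c)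
    · rcases lt_trichotomy (c : ℕ) 1 with hc | hc | hc
      · right; right; right
        rw [cross_lrl, ha]
        have hc : (c : ℕ) = 0 := by omega
        exact ⟨mul_neg_of_pos_of_neg (by positivity) (by rw [hc]; norm_num), by simp [hc]⟩
      · exact Or.inl ⟨congrArg _ (Fin.ext (hc.trans ha.symm)), by simp [hc]⟩
      · right; right; left
        rw [cross_lrl, ha]
        have h1 : (1 : ℝ) < (c : ℕ) := by exact_mod_cast hc
        refine ⟨mul_pos (by positivity) (by push_cast; linarith), ?_⟩
        rw [Sum.elim_inl, if_neg (by omega), if_neg (by omega)]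
        norm_num
    · have hck := c.2
      right
      by_cases hcj : c = j
      · left
        refine ⟨congrArg _ hcj, ?_⟩
        subst hcj
        rw [Sum.elim_inr, if_pos (by omega), if_neg (by omega)]
        norm_num
      have hcj' : (c : ℕ) ≠ j := fun h => hcj (Fin.ext h)
      have h1 := (chain_mul_mem (Ne.symm hcj)).2
      rw [cross_lrr, ha]
      right
      rcases hcj'.lt_or_gt with h | h
      · right
        have h2 := chain_lt_chain (show c < j from h)
        refine ⟨mul_neg_of_pos_of_neg h2 (by push_cast; linarith), ?_⟩
        rw [Sum.elim_inr, if_neg (by omega), if_neg (by omega)]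
        norm_num
      · left
        have h2 := chain_lt_chain (show j < c from h)
        refine ⟨mul_pos_of_neg_of_neg (by linarith) (by push_cast; linarith), ?_⟩
        rw [Sum.elim_inr, if_neg (by omega), if_pos (by omega)]
        norm_num
  · simp only [Fintype.sum_sum_type, Sum.elim_inl, Sum.elim_inr, Finset.sum_sub_distrib,
      Finset.sum_add_distrib, ← Finset.mul_sum, sum_ite_val_eq j.pos, sum_ite_val_eq (ha ▸ a.2),
      sum_ite_val_eq (show k - 2 < k by omega), sum_ite_val_eq (show k - 1 < k by omega)]
    simp

end Star

/-! ### Paths as lists, and closing them to cycles -/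

/-- A nonempty list with consecutive elements related, from `u` to `v`. -/
structure IsListPath {V : Type*} (R : V → V → Prop) (u v : V) (l : List V) : Prop where
  isChain : l.IsChain R
  head : l.head? = some u
  last : l.getLast? = some v

namespace IsListPath

variable {V W : Type*} {R : V → V → Prop} {u v w x : V} {l l' : List V}

theorem singleton (u : V) : IsListPath R u u [u] := ⟨by simp, rfl, rfl⟩

theorem append (h : IsListPath R u v l) (hvw : R v w) (h' : IsListPath R w x l') :
    IsListPath R u x (l ++ l') := by
  refine ⟨List.isChain_append.2 ⟨h.isChain, h'.isChain, ?_⟩, ?_, ?_⟩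
  · rw [h.last, h'.head]
    rintro a ⟨⟩ b ⟨⟩
    exact hvw
  · simp [List.head?_append, h.head]
  · simp [List.getLast?_append, h'.last]

theorem reverse (hR : ∀ a b, R a b → R b a) (h : IsListPath R u v l) :
    IsListPath R v u l.reverse := by
  refine ⟨List.isChain_reverse.2 (h.isChain.imp hR), ?_, ?_⟩
  · rw [List.head?_reverse, h.last]
  · rw [List.getLast?_reverse, h.head]

theorem map {R' : W → W → Prop} (f : V → W) (hf : ∀ a b, R a b → R' (f a) (f b))
    (h : IsListPath R u v l) : IsListPath R' (f u) (f v) (l.map f) := by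
  refine ⟨(List.isChain_map f).2 (h.isChain.imp hf), ?_, ?_⟩
  · rw [List.head?_map, h.head]; rfl
  · rw [List.getLast?_map, h.last]; rfl

theorem map_range (f : ℕ → V) (n : ℕ) (hf : ∀ m < n, R (f m) (f (m + 1))) :
    IsListPath R (f 0) (f n) ((List.range (n + 1)).map f) := by
  refine ⟨?_, ?_, ?_⟩
  · rw [List.isChain_map, List.isChain_range_succ]
    exact hf
  · simp [List.head?_range]
  · simp [List.getLast?_range]

theorem exists_isCycle {G : SimpleGraph V} (h : IsListPath G.Adj u v l) (hvu : G.Adj v u)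
    (hl : l.Nodup) (h3 : 3 ≤ l.length) :
    ∃ (w : V) (c : G.Walk w w), c.IsCycle ∧ c.length = l.length := by
  have hne : l ≠ [] := by rintro rfl; simp at h3
  have hu : l.head hne = u := by simpa [List.head?_eq_some_head hne] using h.head
  have hv : l.getLast hne = v := by simpa [List.getLast?_eq_some_getLast hne] using h.last
  set p := SimpleGraph.Walk.ofSupport l hne h.isChain with hp
  have hlen : p.length = l.length - 1 := SimpleGraph.Walk.length_ofSupport hne h.isChain
  have hpath : p.IsPath := by
    rw [SimpleGraph.Walk.isPath_def, hp, SimpleGraph.Walk.support_ofSupport]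
    exact hl
  have hadj : G.Adj (l.getLast hne) (l.head hne) := by rwa [hu, hv]
  refine ⟨_, SimpleGraph.Walk.cons hadj p, ?_, ?_⟩
  · rw [SimpleGraph.Walk.cons_isCycle_iff]
    refine ⟨hpath, fun hmem => ?_⟩
    -- A path containing the edge between its own ends has length one, but here there are at least
    -- three vertices.
    have := hpath.length_eq_one_of_mem_edges (Sym2.eq_swap ▸ hmem)
    omega
  · rw [SimpleGraph.Walk.length_cons, hlen]
    omega

end IsListPath

/-! ### The long cycle -/

namespace Star

variable {n : ℕ}

/-- With `k = n + 2` the inner points 0 and 1 and the penultimate chain index `n` all exist. Indices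
are reduced modulo `n + 2`, so the winding closes up at 0. -/
def inner (i : Fin 3) (a : ℕ) : StarLabel (n + 2) := (i, .inl (Fin.ofNat (n + 2) a))
def outer (i : Fin 3) (j : ℕ) : StarLabel (n + 2) := (i, .inr (Fin.ofNat (n + 2) j))

theorem val_ofNat_of_lt {a : ℕ} (ha : a < n + 2) : (Fin.ofNat (n + 2) a : ℕ) = a :=
  Nat.mod_eq_of_lt ha

theorem inner_inj {i j : Fin 3} {a b : ℕ} (ha : a < n + 2) (hb : b < n + 2)
    (h : (inner i a : StarLabel (n + 2)) = inner j b) : i = j ∧ a = b := by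
  simp only [inner, Prod.mk.injEq, Sum.inl.injEq] at h
  refine ⟨h.1, ?_⟩
  rw [← val_ofNat_of_lt ha, h.2, val_ofNat_of_lt hb]

theorem outer_inj {i j : Fin 3} {a b : ℕ} (ha : a < n + 2) (hb : b < n + 2)
    (h : (outer i a : StarLabel (n + 2)) = outer j b) : i = j ∧ a = b := by
  simp only [outer, Prod.mk.injEq, Sum.inr.injEq] at h
  refine ⟨h.1, ?_⟩
  rw [← val_ofNat_of_lt ha, h.2, val_ofNat_of_lt hb]

theorem inner_ne_outer {i j : Fin 3} {a b : ℕ} : (inner i a : StarLabel (n + 2)) ≠ outer j b := by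
  simp [inner, outer]

theorem isEdge_of_ne_zero {k : ℕ} (i : Fin 3) (hi : i + 1 ≠ 0) (a : Fin k) :
    IsEdge (i, .inl a) (i + 1, .inl a) :=
  isEdge_next_arm i (by rw [viewOrder, if_neg hi]; rfl)

theorem isEdge_finRotate {k : ℕ} (a : Fin k) :
    IsEdge ((2 : Fin 3), .inl a) (0, .inl (finRotate k a)) :=
  isEdge_next_arm 2 (by rw [viewOrder, if_pos (by decide), Equiv.symm_apply_apply])

theorem isEdge_inner_zero_one (a : ℕ) : IsEdge (inner 0 a : StarLabel (n + 2)) (inner 1 a) :=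
  isEdge_of_ne_zero 0 (by decide) _

theorem isEdge_inner_one_two (a : ℕ) : IsEdge (inner 1 a : StarLabel (n + 2)) (inner 2 a) :=
  isEdge_of_ne_zero 1 (by decide) _

theorem isEdge_inner_two_zero (a : ℕ) :
    IsEdge (inner 2 a : StarLabel (n + 2)) (inner 0 (a + 1)) := by
  have h := isEdge_finRotate (Fin.ofNat (n + 2) a)
  rw [finRotate_apply] at h
  have : Fin.ofNat (n + 2) a + 1 = Fin.ofNat (n + 2) (a + 1) := by
    ext; simp [Fin.val_add]
  rwa [this] at h

theorem isEdge_inner_two_zero_wrap :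
    IsEdge (inner 2 (n + 1) : StarLabel (n + 2)) (inner 0 0) := by
  have h := isEdge_inner_two_zero (n := n) (n + 1)
  have : (inner 0 (n + 1 + 1) : StarLabel (n + 2)) = inner 0 0 := by
    simp [inner]
  rwa [this] at h

theorem isEdge_inner_outer_first (i : Fin 3) :
    IsEdge (inner i 0 : StarLabel (n + 2)) (outer i 0) :=
  isEdge_first i (by simp) (by simp)

theorem isEdge_inner_outer_last (i : Fin 3) :
    IsEdge (inner i 1 : StarLabel (n + 2)) (outer i n) :=
  isEdge_second i (val_ofNat_of_lt (by omega)) (by rw [val_ofNat_of_lt (by omega)])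

/-- The chain of an arm without its outermost point. -/
def chainList (n : ℕ) (i : Fin 3) : List (StarLabel (n + 2)) := (List.range (n + 1)).map (outer i)

/-- The part of the inner cycle winding around the centre. -/
def windingList (n : ℕ) (m : ℕ) : List (StarLabel (n + 2)) :=
  (List.range m).flatMap fun a => [inner 0 (a + 2), inner 1 (a + 2), inner 2 (a + 2)]

/-- The vertices of the cycle for `n + 2` points in each cluster. -/
def cycleList (n : ℕ) : List (StarLabel (n + 2)) :=
  [inner 2 0] ++ chainList n 2 ++ (inner 2 1 :: windingList n n) ++ [inner 0 0] ++ chainList n 0 ++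
    [inner 0 1] ++ [inner 1 1] ++ (chainList n 1).reverse ++ [inner 1 0]

theorem isListPath_chainList (i : Fin 3) :
    IsListPath IsEdge (outer i 0) (outer i n) (chainList n i) :=
  IsListPath.map_range _ _ fun m hm =>
    isEdge_chain i (by rw [val_ofNat_of_lt (by omega), val_ofNat_of_lt (by omega)])

theorem isListPath_windingList (m : ℕ) :
    IsListPath IsEdge (inner 2 1) (inner 2 (m + 1)) (inner 2 1 :: windingList n m) := by
  induction m with
  | zero => exact IsListPath.singleton _
  | succ m ih =>
    have h : inner 2 1 :: windingList n (m + 1) = (inner 2 1 :: windingList n m) ++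
        ([inner 0 (m + 2)] ++ [inner 1 (m + 2)] ++ [inner 2 (m + 2)]) := by
      simp [windingList, List.range_succ]
    rw [h]
    exact ih.append (isEdge_inner_two_zero (m + 1)) (((IsListPath.singleton _).append
      (isEdge_inner_zero_one _) (IsListPath.singleton _)).append (isEdge_inner_one_two _)
      (IsListPath.singleton _))

/-- In the inner cycle the stretch 0₀ 1₀ 2₀ 0₁ 1₁ 2₁ (arm, with index as subscript) loses the edges
0₀1₀, 2₀0₁ and 1₁2₁. The chain paths reconnect it as 0₀ ~ 0₁ 1₁ ~ 1₀ 2₀ ~ 2₁, so arm 1 is traversed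
backwards. -/
theorem isListPath_cycleList : IsListPath IsEdge (inner 2 0) (inner 1 0) (cycleList n) :=
  ((((((((IsListPath.singleton _).append (isEdge_inner_outer_first 2)
    (isListPath_chainList 2)).append (isEdge_inner_outer_last 2).symm
    (isListPath_windingList n)).append isEdge_inner_two_zero_wrap
    (IsListPath.singleton _)).append (isEdge_inner_outer_first 0)
    (isListPath_chainList 0)).append (isEdge_inner_outer_last 0).symm
    (IsListPath.singleton _)).append (isEdge_inner_zero_one 1)
    (IsListPath.singleton _)).append (isEdge_inner_outer_last 1)
    ((isListPath_chainList 1).reverse fun _ _ h => h.symm)).append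
    (isEdge_inner_outer_first 1).symm (IsListPath.singleton _)

theorem length_cycleList : (cycleList n).length = 6 * (n + 2) - 3 := by
  have : (windingList n n).length = 3 * n := by
    simp [windingList, List.length_flatMap, mul_comm]
  simp [cycleList, chainList, this]
  omega

theorem nodup_chainList (i : Fin 3) : (chainList n i).Nodup := by
  refine List.Nodup.map_on (fun a ha b hb h => ?_) List.nodup_range
  rw [List.mem_range] at ha hb
  exact (outer_inj (by omega) (by omega) h).2

theorem mem_windingList {m : ℕ} {l : StarLabel (n + 2)} (h : l ∈ windingList n m) :
    ∃ i a, a < m ∧ l = inner i (a + 2) := by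
  simp only [windingList, List.mem_flatMap, List.mem_range, List.mem_cons, List.not_mem_nil,
    or_false] at h
  obtain ⟨a, ha, h⟩ := h
  rcases h with h | h | h
  exacts [⟨_, a, ha, h⟩, ⟨_, a, ha, h⟩, ⟨_, a, ha, h⟩]

theorem nodup_windingList {m : ℕ} (hm : m ≤ n) : (windingList n m).Nodup := by
  rw [windingList, List.nodup_flatMap]
  constructor
  · intro a _
    simp [inner]
  · refine List.nodup_range.imp_of_mem fun {a b} ha hb hab => ?_
    rw [List.mem_range] at ha hb
    rw [Function.onFun, List.disjoint_left]
    intro x hx hx'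
    simp only [List.mem_cons, List.not_mem_nil, or_false] at hx hx'
    have key : ∀ i j, x = inner i (a + 2) → x ≠ inner j (b + 2) := by
      rintro i j rfl h
      have := (inner_inj (by omega) (by omega) h).2
      omega
    rcases hx with hx | hx | hx <;> rcases hx' with hx' | hx' | hx' <;> exact key _ _ hx hx'

theorem inner_notMem_windingList {i : Fin 3} {a : ℕ} (ha : a < 2) :
    inner i a ∉ windingList n n := by
  intro h
  obtain ⟨j, b, hb, h⟩ := mem_windingList h
  have := (inner_inj (by omega) (by omega) h).2
  omega

theorem outer_notMem_windingList {i : Fin 3} {a : ℕ} : outer i a ∉ windingList n n := by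
  intro h
  obtain ⟨j, b, _, h⟩ := mem_windingList h
  exact inner_ne_outer h.symm

theorem nodup_cycleList : (cycleList n).Nodup := by
  have h01 : ∀ i j : Fin 3, (inner i 0 : StarLabel (n + 2)) ≠ inner j 1 := fun i j h => by
    have := (inner_inj (by omega) (by omega) h).2
    omega
  have hne : ∀ i j : Fin 3, ∀ a b : ℕ, i ≠ j → (inner i a : StarLabel (n + 2)) ≠ inner j b :=
    fun i j a b hij h => hij (congrArg Prod.fst h)
  have hne' : ∀ i j : Fin 3, ∀ a b : ℕ, i ≠ j → (outer i a : StarLabel (n + 2)) ≠ outer j b :=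
    fun i j a b hij h => hij (congrArg Prod.fst h)
  have hc : ∀ i : Fin 3, ∀ l : StarLabel (n + 2), l ∈ chainList n i → ∃ a, l = outer i a := by
    intro i l hl
    obtain ⟨a, _, rfl⟩ := List.mem_map.1 hl
    exact ⟨a, rfl⟩
  have hic : ∀ i j a, inner j a ∉ chainList n i := fun i j a h => by
    obtain ⟨b, hb⟩ := hc _ _ h
    exact inner_ne_outer hb
  have hcc : ∀ i j, i ≠ j → (chainList n i).Disjoint (chainList n j) := by
    intro i j hij l h h'
    obtain ⟨a, rfl⟩ := hc _ _ h
    obtain ⟨b, hb⟩ := hc _ _ h'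
    exact hne' _ _ _ _ hij hb
  have hwc : ∀ i, (windingList n n).Disjoint (chainList n i) := by
    intro i l h h'
    obtain ⟨a, rfl⟩ := hc _ _ h'
    exact outer_notMem_windingList h
  have hcr : ∀ {l : List (StarLabel (n + 2))}, l.Disjoint (chainList n 1) →
      l.Disjoint (chainList n 1).reverse := fun h a ha ha' => h ha (List.mem_reverse.1 ha')
  simp only [cycleList, List.nodup_append', List.disjoint_append_left, List.disjoint_cons_left,
    List.disjoint_cons_right, List.disjoint_nil_left, List.disjoint_nil_right,
    List.nodup_cons, List.nodup_nil, List.nodup_reverse, List.mem_append, List.mem_cons,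
    List.mem_reverse, List.not_mem_nil, hic, nodup_chainList, nodup_windingList le_rfl,
    inner_notMem_windingList (show 0 < 2 by decide), inner_notMem_windingList (show 1 < 2 by decide),
    h01, fun i j => (h01 j i).symm,
    hne _ _ _ _ (show (0 : Fin 3) ≠ 2 by decide), hne _ _ _ _ (show (1 : Fin 3) ≠ 2 by decide),
    hne _ _ _ _ (show (1 : Fin 3) ≠ 0 by decide), hwc, (hwc _).symm, hcr (hwc 1),
    hcc _ _ (show (2 : Fin 3) ≠ 0 by decide), hcr (hcc _ _ (show (2 : Fin 3) ≠ 1 by decide)),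
    hcr (hcc _ _ (show (0 : Fin 3) ≠ 1 by decide)), or_self, not_false_eq_true, and_self]

/-- A list path through all labels but three which closes up to a cycle. -/
theorem exists_cycle_list {k : ℕ} (hk : 0 < k) : ∃ (u v : StarLabel k) (l : List (StarLabel k)),
    IsListPath IsEdge u v l ∧ IsEdge v u ∧ l.Nodup ∧ l.length = 6 * k - 3 := by
  obtain _ | _ | n := k
  · omega
  -- For `k = 1` there is no inner point 1; the triangle of inner points already has length `6 - 3`.
  · refine ⟨((0 : Fin 3), .inl 0), (2, .inl 0), [(0, .inl 0)] ++ [(1, .inl 0)] ++ [(2, .inl 0)],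
      ((IsListPath.singleton _).append (isEdge_of_ne_zero 0 (by decide) _)
        (IsListPath.singleton _)).append (isEdge_of_ne_zero 1 (by decide) _)
        (IsListPath.singleton _), ?_, by simp, by simp⟩
    have := isEdge_finRotate (0 : Fin 1)
    rwa [Subsingleton.elim (finRotate 1 0) 0] at this
  · exact ⟨_, _, _, isListPath_cycleList, (isEdge_inner_one_two 0), nodup_cycleList,
      length_cycleList⟩

/-! ### Realisation at one value of `ε` -/

variable {k : ℕ}

/-- Two coinciding points would be collinear with any third one, and a third label always exists. -/
theorem point_injective {ε : ℝ} (h : ∀ p q r : StarLabel k, p ≠ q → p ≠ r → q ≠ r →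
    orient (point ε p) (point ε q) (point ε r) ≠ 0) : Function.Injective (point (k := k) ε) := by
  intro p q hpq
  by_contra hne
  obtain ⟨r, hr⟩ : ∃ r : StarLabel k, r ∉ ({p, q} : Finset (StarLabel k)) := by
    by_contra! hall
    have h1 := Finset.card_le_card (fun x _ => hall x : Finset.univ ⊆ {p, q})
    have h2 := Finset.card_le_two (a := p) (b := q)
    rw [Finset.card_univ] at h1
    simp only [StarLabel, Fintype.card_prod, Fintype.card_sum, Fintype.card_fin] at h1
    obtain ⟨i, a⟩ := p
    have : 0 < k := by
      rcases a with a | a <;> exact a.pos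
    omega
  simp only [Finset.mem_insert, Finset.mem_singleton, not_or] at hr
  refine h p q r hne (Ne.symm hr.1) (Ne.symm hr.2) ?_
  rw [hpq]
  simp [orient]

theorem isHalvingPair_of_imbalance {ε : ℝ} (hinj : Function.Injective (point (k := k) ε))
    {p q : StarLabel k} (hpq : p ≠ q) (h : imbalance ε p q = 0) :
    IsHalvingPair (Finset.univ.image (point (k := k) ε)) (point ε p) (point ε q) := by
  refine ⟨hinj.ne hpq, ?_⟩
  have hsign : ∀ x : ℝ, (SignType.sign x : ℤ) =
      (if 0 < x then 1 else 0) - (if x < 0 then 1 else 0) := by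
    intro x
    rcases lt_trichotomy x 0 with hx | rfl | hx
    · simp [sign_neg hx, hx, hx.not_gt]
    · simp
    · simp [sign_pos hx, hx, hx.not_gt]
  simp only [imbalance, hsign, Finset.sum_sub_distrib, Finset.sum_boole, sub_eq_zero,
    Nat.cast_inj] at h
  rw [Finset.filter_image, Finset.filter_image, Finset.card_image_of_injective _ hinj,
    Finset.card_image_of_injective _ hinj]
  exact h

theorem exists_configuration (hk : 0 < k) : ∃ S : Finset Plane, IsConfiguration (6 * k) S ∧
    ∃ (v : S) (c : (underlyingGraph S).Walk v v), c.IsCycle ∧ c.length = 6 * k - 3 := by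
  have hgen : ∀ᶠ ε in 𝓝[>] (0 : ℝ), ∀ p q r : StarLabel k, p ≠ q → p ≠ r → q ≠ r →
      orient (point ε p) (point ε q) (point ε r) ≠ 0 := by
    simp only [eventually_all]
    exact fun p q r hpq hpr hqr => generic_of_ne hpq hpr hqr
  have hedge : ∀ᶠ ε in 𝓝[>] (0 : ℝ), ∀ p q : StarLabel k, IsEdge p q → imbalance ε p q = 0 := by
    simp only [eventually_all]
    exact fun p q h => h.2
  -- There are finitely many labels, so one `ε` serves all triples and all edges.
  obtain ⟨ε, hgen, hedge⟩ := (hgen.and hedge).exists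
  have hinj := point_injective hgen
  set S : Finset Plane := Finset.univ.image (point (k := k) ε) with hS
  refine ⟨S, ⟨?_, ?_⟩, ?_⟩
  · rw [hS, Finset.card_image_of_injective _ hinj]
    simp
    ring
  · intro p hp q hq r hr hpq hpr hqr hcol
    obtain ⟨p, -, rfl⟩ := Finset.mem_image.1 hp
    obtain ⟨q, -, rfl⟩ := Finset.mem_image.1 hq
    obtain ⟨r, -, rfl⟩ := Finset.mem_image.1 hr
    exact hgen p q r (fun h => hpq (by rw [h])) (fun h => hpr (by rw [h]))
      (fun h => hqr (by rw [h])) (orient_eq_zero_of_collinear hcol)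
  · obtain ⟨u, v, l, hpath, hvu, hnodup, hlen⟩ := exists_cycle_list hk
    set φ : StarLabel k → S := fun l => ⟨point ε l, Finset.mem_image_of_mem _ (Finset.mem_univ l)⟩
    have hφ : Function.Injective φ := fun a b hab => hinj (congrArg Subtype.val hab)
    have hadj : ∀ a b, IsEdge a b → (underlyingGraph S).Adj (φ a) (φ b) := fun a b hab =>
      isHalvingPair_of_imbalance hinj hab.1 (hedge a b hab)
    have hlen' : (l.map φ).length = 6 * k - 3 := by rw [List.length_map, hlen]
    rw [← hlen']
    exact (hpath.map φ hadj).exists_isCycle (hadj _ _ hvu) (hnodup.map hφ) (by omega)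

end Star

theorem mainTheorem7 :
    (∀ n : ℕ, Even n → ∀ S : Finset Plane, IsConfiguration n S →
      ∀ (v : S) (c : (underlyingGraph S).Walk v v), c.IsCycle →
        (∀ w ∈ c.support, ¬ IsHullVertex S w) ∧ c.length + 3 ≤ n) ∧
    (∀ n : ℕ, 0 < n → 6 ∣ n →
      IsGreatest
        {k : ℕ | ∃ S : Finset Plane, IsConfiguration n S ∧
          ∃ (v : S) (c : (underlyingGraph S).Walk v v), c.IsCycle ∧ c.length = k}
        (n - 3)) := by
  refine ⟨?_, ?_⟩
  · rintro n - S ⟨hn, hS⟩ v c hc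
    exact ⟨fun w hw => not_isHullVertex_of_mem_cycle hS hc hw,
      hn ▸ cycle_length_add_three_le hS hc⟩
  · rintro n hn ⟨k, rfl⟩
    refine ⟨Star.exists_configuration (by omega), ?_⟩
    rintro m ⟨S, ⟨hn, hS⟩, v, c, hc, rfl⟩
    have := cycle_length_add_three_le hS hc
    omega
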